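/- Let $X$ be a finite set with at least two elements and let $(X,\{R_\alpha\}_{\alpha\in\mathcal I})$ be a commutative association scheme with adjacency matrices $A_\alpha$: the nonempty relations $R_\alpha$ partition $X^2$, one of them is the diagonal, the inverse of each relation is again one of them, and there are intersection numbers $p_{\alpha\beta}^{\delta}=p_{\beta\alpha}^{\delta}$. Let $\le$ be a monomial order on $\mathbb N^\ell$ that is graded (i.e. $a\le b$ implies $|a|\le|b|$, where $|a|=a_1+\cdots+a_\ell$), let $\epsilon_1,\dots,\epsilon_\ell$ be the unit vectors, and let $\mathcal D^*\subset\mathbb N^\ell$ be a finite set containing $\epsilon_1,\dots,\epsilon_\ell$. Assume that the scheme is $\ell$-variate $Q$-polynomial on $\mathcal D^*$ with respect to $\le$. That is, $\mathcal D^*$ is closed under passing to componentwise smaller tuples, and the primitive idempotents of the Bose–Mesner algebra are labelled $\{E_\gamma\}_{\gamma\in\mathcal D^*}$ in such a way that, all products and powers of matrices below being entrywise (Hadamard): (i) for every $\alpha\in\mathcal D^*$, $|X|E_\alpha=v_\alpha^*(|X|E_{\epsilon_1},\dots,|X|E_{\epsilon_\ell})$ for some polynomial $v_\alpha^*$ of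 multidegree $\alpha$ with respect to $\le$ (so of total degree $|\alpha|$), all of whose monomials $x^\beta$ satisfy $\beta\in\mathcal D^*$; (ii) for every $i$ and every $\alpha\in\mathcal D^*$, the product $E_{\epsilon_i}\circ E_{\epsilon_1}^{\circ\alpha_1}\circ\cdots\circ E_{\epsilon_\ell}^{\circ\alpha_\ell}$ is a linear combination of the products $E_{\epsilon_1}^{\circ\beta_1}\circ\cdots\circ E_{\epsilon_\ell}^{\circ\beta_\ell}$ with $\beta\in\mathcal D^*$ and $\beta\le\alpha+\epsilon_i$. Let $\mu_\gamma=\operatorname{rank}E_\gamma$, and let $Q_\gamma(\alpha)$ be the second eigenvalues, defined by $|X|E_\gamma=\sum_{\alpha}Q_\gamma(\alpha)A_\alpha$. Assume that the points $z_\alpha=(Q_{\epsilon_1}(\alpha),\dots,Q_{\epsilon_\ell}(\alpha))$, $\alpha\in\mathcal I$, lie in $\mathbb R^\ell$. For $T\subseteq\mathcal D^*\setminus\{0\}$, a nonempty set $Y\subseteq X$ is a $T$-design if $\sum_{\alpha}a_\alpha Q_\gamma(\alpha)=0$ for all $\gamma\in T$, where $a_\alpha=|R_\alpha\cap Y^2|/|Y|$.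 Put $$e(T)=\max\{m\ge 0:\ \{\gamma\in\mathcal D^*: 0<|\gamma|\le 2m\}\subseteq T\},$$ with $e(T)=\infty$ if every $m$ qualifies, i.e. if $T=\mathcal D^*\setminus\{0\}$. Then every $T$-design $Y$ satisfies the degree Rao bound $$|Y|\ \ge\ \sum_{\gamma\in\mathcal D^*,\ |\gamma|\le e(T)}\mu_\gamma .$$ -/

import Mathlib

open scoped MonomialOrder

noncomputable section

/-- A commutative association scheme on the finite set `X`, with relations indexed by `I`. -/
structure AssocScheme (X I : Type*) [Fintype X] where
  /-- `rel i x y` means `(x, y) ∈ R_i`. -/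
  rel : I → X → X → Prop
  /-- The index of the diagonal relation. -/
  diagIdx : I
  rel_nonempty : ∀ i, ∃ x y, rel i x y
  rel_partition : ∀ x y, ∃! i, rel i x y
  rel_diag : ∀ x y, rel diagIdx x y ↔ x = y
  rel_inv : ∀ i, ∃ j, ∀ x y, rel j x y ↔ rel i y x
  /-- The intersection numbers `p_{ij}^k`. -/
  p : I → I → I → ℕ
  p_comm : ∀ i j k, p i j k = p j i k
  card_eq : ∀ i j k x y, rel k x y → Nat.card {z : X // rel i x z ∧ rel j z y} = p i j k

namespace AssocScheme

variable {X I : Type*} [Fintype X] (S : AssocScheme X I)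

open Classical in
/-- The adjacency matrix `A_i`. -/
def adj (i : I) : Matrix X X ℂ := Matrix.of fun x y => if S.rel i x y then 1 else 0

/-- The Bose-Mesner algebra, as the complex span of the adjacency matrices. -/
def boseMesner : Submodule ℂ (Matrix X X ℂ) := Submodule.span ℂ (Set.range S.adj)

open Classical in
/-- `E` is the family of primitive idempotents: the basis of the Bose-Mesner algebra consisting of
pairwise orthogonal idempotents with sum the identity. -/
structure IsPrimitiveIdempotents {J : Type*} [Fintype J] (E : J → Matrix X X ℂ) : Prop where
  linearIndependent : LinearIndependent ℂ E
  span_eq : Submodule.span ℂ (Set.range E) = S.boseMesner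
  idem : ∀ j, E j * E j = E j
  orth : ∀ j k, j ≠ k → E j * E k = 0
  sum_eq_one : ∑ j, E j = 1

/-- The coefficient at `A_i` of `|X| • M`, for `M` in the Bose-Mesner algebra. It is `|X|` times the
common value of `M` on the relation `R_i`; for `M = E_γ` it is the second eigenvalue `Q_γ(i)`. -/
def secondEigenvalue (M : Matrix X X ℂ) (i : I) : ℂ :=
  (Fintype.card X : ℂ) * M (S.rel_nonempty i).choose (S.rel_nonempty i).choose_spec.choose

theorem secondEigenvalue_spec [Fintype I] (M : Matrix X X ℂ) (hM : M ∈ S.boseMesner) :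
    (Fintype.card X : ℂ) • M = ∑ i, S.secondEigenvalue M i • S.adj i := by
  classical
  have key : ∀ i x y x' y', S.rel i x y → S.rel i x' y' → M x y = M x' y' := by
    intro i x y x' y' h h'
    refine Submodule.span_induction (p := fun N _ => N x y = N x' y') ?_ rfl ?_ ?_ hM
    · rintro _ ⟨j, rfl⟩
      have e : S.rel j x y ↔ S.rel j x' y' := by
        constructor
        · intro hj
          rwa [(S.rel_partition x y).unique hj h]
        · intro hj
          rwa [(S.rel_partition x' y').unique hj h']
      simp [adj, e]
    · intro A B _ _ hA hB
      simp [hA, hB]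
    · intro c A _ hA
      simp [hA]
  ext x y
  obtain ⟨i, hi, hu⟩ := S.rel_partition x y
  rw [Matrix.sum_apply, Finset.sum_eq_single i]
  · have hs := (S.rel_nonempty i).choose_spec.choose_spec
    simp [adj, hi, secondEigenvalue, key i _ _ _ _ hi hs]
  · intro j _ hj
    have : ¬ S.rel j x y := fun h => hj (hu j h)
    simp [adj, this]
  · simp

/-- The polynomial `v` has multidegree `n` for the monomial order `m`. -/
def HasMultidegree {l : ℕ} (m : MonomialOrder (Fin l)) (v : MvPolynomial (Fin l) ℂ)
    (n : Fin l →₀ ℕ) : Prop :=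
  v.coeff n ≠ 0 ∧ ∀ a ∈ v.support, a ≼[m] n

/-- The entrywise (Hadamard) monomial `F_1^{∘ n_1} ∘ ⋯ ∘ F_l^{∘ n_l}`. -/
def hadamardMonomial {l : ℕ} (F : Fin l → Matrix X X ℂ) (n : Fin l →₀ ℕ) : Matrix X X ℂ :=
  Matrix.of fun x y => ∏ i, F i x y ^ n i

/-- The scheme `S`, with its primitive idempotents labelled as `E_α`, `α ∈ D`, is `l`-variate
`Q`-polynomial on the domain `D` with respect to the monomial order `m`. Evaluating a polynomial
under the Hadamard product means evaluating it entry by entry. -/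
structure IsQPolynomial {l : ℕ} (m : MonomialOrder (Fin l)) (D : Finset (Fin l →₀ ℕ))
    (E : D → Matrix X X ℂ) : Prop where
  primitive : S.IsPrimitiveIdempotents E
  eps_mem : ∀ i, Finsupp.single i 1 ∈ D
  lower : ∀ n ∈ D, ∀ k, (∀ i, k i ≤ n i) → k ∈ D
  poly : ∀ α : D, ∃ v : MvPolynomial (Fin l) ℂ,
    HasMultidegree m v α ∧ (∀ β ∈ v.support, β ∈ D) ∧
    ∀ x y, (Fintype.card X : ℂ) * E α x y =
      MvPolynomial.eval
        (fun i => (Fintype.card X : ℂ) * E ⟨Finsupp.single i 1, eps_mem i⟩ x y) v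
  mul_eps : ∀ (i : Fin l), ∀ α ∈ D,
    Matrix.hadamard (E ⟨Finsupp.single i 1, eps_mem i⟩)
        (hadamardMonomial (fun j => E ⟨Finsupp.single j 1, eps_mem j⟩) α) ∈
      Submodule.span ℂ
        {N | ∃ β ∈ D, β ≼[m] (α + Finsupp.single i 1) ∧
          N = hadamardMonomial (fun j => E ⟨Finsupp.single j 1, eps_mem j⟩) β}

/-- The inner distribution `a_i = |R_i ∩ Y²| / |Y|`. -/
def innerDistribution (Y : Finset X) (i : I) : ℝ :=
  (Nat.card {q : X × X // q.1 ∈ Y ∧ q.2 ∈ Y ∧ S.rel i q.1 q.2} : ℝ) / (Y.card : ℝ)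

/-- `Y` is a `T`-design: `(aQ)_γ = 0` for all `γ ∈ T`, with `a` the inner distribution of `Y`. -/
def IsTDesign [Fintype I] {l : ℕ} {D : Finset (Fin l →₀ ℕ)} (E : D → Matrix X X ℂ)
    (T : Set (Fin l →₀ ℕ)) (Y : Finset X) : Prop :=
  ∀ γ : D, (γ : Fin l →₀ ℕ) ∈ T →
    ∑ i, (S.innerDistribution Y i : ℂ) * S.secondEigenvalue (E γ) i = 0

end AssocScheme

/-- `e(T)`, the largest `m` with `{γ ∈ D : 0 < |γ| ≤ 2m} ⊆ T`. The value `m = 0` always qualifies;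
the supremum is `⊤` exactly when every `m` qualifies, that is, when `T` contains every nonzero
element of `D`. Here `|γ| = γ_1 + ⋯ + γ_l` is `γ.degree`. -/
def designStrength {l : ℕ} (D : Finset (Fin l →₀ ℕ)) (T : Set (Fin l →₀ ℕ)) : ℕ∞ :=
  sSup {e : ℕ∞ | ∃ m : ℕ, e = m ∧ ∀ γ ∈ D, 0 < γ.degree → γ.degree ≤ 2 * m → γ ∈ T}

end

/-! Let `k` be the largest degree occurring in the Rao sum, and let `P` and `Q` be the orthogonal
projections onto the eigenspaces of degree at most `k` and at most `2k`. The Hadamard monomials and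
the idempotents of degree at most `k` span the same space (`hadamardSpan_eq_span`), and the Hadamard
recurrence makes this filtration multiplicative. Since the generators are real, `P ∘ conj P`
therefore lies in degree at most `2k` and is fixed by `Q`. Positivity passes from matrices to
functions: a product of a column of `P` with a conjugated column is itself fixed by `Q`
(`Matrix.sum_mul_column_mul_star_column`). On functions fixed by `Q`, averaging over the design `Y`
agrees with averaging over `X`. So `P` is a scalar multiple of the Gram matrix `Rᴴ R`, where `R`
consists of the rows of `P` indexed by `Y`, and its rank is at most `|Y|`. That rank is the Rao sum,
because ranks of orthogonal idempotents add. -/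

open scoped ComplexOrder in
open Matrix in
/-- A normal idempotent matrix is Hermitian. -/
theorem Matrix.isHermitian_of_idempotent_of_commute {X : Type*} [Fintype X] {E : Matrix X X ℂ}
    (hE : E * E = E) (hc : Eᴴ * E = E * Eᴴ) : E.IsHermitian := by
  have hE' : Eᴴ * Eᴴ = Eᴴ := by rw [← conjTranspose_mul, hE]
  -- By normality all four terms of the expanded product equal `Eᴴ * E`, so they cancel; `Bᴴ * B =
  -- 0` then forces `B = 0`.
  have h : (Eᴴ - Eᴴ * E)ᴴ * (Eᴴ - Eᴴ * E) = 0 := by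
    have h₁ : E * (Eᴴ * E) = Eᴴ * E := by rw [hc, ← mul_assoc, hE]
    have h₂ : Eᴴ * E * Eᴴ = Eᴴ * E := by rw [mul_assoc, ← hc, ← mul_assoc, hE']
    have h₃ : Eᴴ * E * (Eᴴ * E) = Eᴴ * E := by rw [← mul_assoc, h₂, mul_assoc, hE]
    rw [conjTranspose_sub, conjTranspose_mul, conjTranspose_conjTranspose, sub_mul, mul_sub,
      mul_sub, h₁, h₂, h₃, ← hc]
    simp
  have h' : Eᴴ = Eᴴ * E := sub_eq_zero.mp (conjTranspose_mul_self_eq_zero.mp h)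
  rw [IsHermitian, h']
  conv_rhs => rw [← conjTranspose_conjTranspose E, h', conjTranspose_mul,
    conjTranspose_conjTranspose]

/-- The trace of an idempotent complex matrix is its rank. -/
theorem Matrix.trace_eq_rank_of_idempotent {X : Type*} [Fintype X] {E : Matrix X X ℂ}
    (hE : E * E = E) : E.trace = (E.rank : ℂ) := by
  classical
  have hi : IsIdempotentElem (Matrix.toLin' E) := by
    rw [IsIdempotentElem, Module.End.mul_eq_comp, ← Matrix.toLin'_mul, hE]
  have h := (LinearMap.IsIdempotentElem.isProj_range _ hi).trace
  rw [Matrix.trace_toLin'_eq] at h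
  exact h

open scoped ComplexOrder in
open Matrix in
/-- If `Q` fixes the Hadamard square `P ∘ conj P` of an orthogonal projection `P`, then it fixes the
entrywise product of any column of `P` with the conjugate of any column of `P`. -/
theorem Matrix.sum_mul_column_mul_star_column {X : Type*} [Fintype X] {P Q : Matrix X X ℂ}
    (hP : P * P = P) (hH : P.IsHermitian)
    (hQ : Q * P.hadamard (P.map star) = P.hadamard (P.map star)) (x y y' : X) :
    ∑ x', Q x x' * (P x' y * star (P x' y')) = P x y * star (P x y') := by
  classical
  -- The columns of `M` are the products in question. As `P * Pᴴ = P`, the Gram matrix `M * Mᴴ` is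
  -- the Hadamard square, and `A * (M * Mᴴ) = 0` implies `A * M = 0`.
  let M : Matrix X (X × X) ℂ := Matrix.of fun x q => P x q.1 * star (P x q.2)
  have hM : M * Mᴴ = P.hadamard (P.map star) := by
    have hPP : ∀ a b, ∑ c, P a c * star (P b c) = P a b := by
      intro a b
      conv_rhs => rw [← hP, mul_apply]
      exact Finset.sum_congr rfl fun c _ => by rw [hH.apply]
    ext a b
    simp only [M, mul_apply, conjTranspose_apply, of_apply, hadamard_apply, map_apply,
      Fintype.sum_prod_type]
    rw [← hPP a b, star_sum, Finset.sum_mul_sum]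
    refine Finset.sum_congr rfl fun c _ => Finset.sum_congr rfl fun d _ => ?_
    simp only [star_mul', star_star]
    ring
  have h : (1 - Q) * (M * Mᴴ) = 0 := by rw [hM, sub_mul, one_mul, hQ, sub_self]
  rw [mul_self_mul_conjTranspose_eq_zero, Matrix.sub_mul, Matrix.one_mul, sub_eq_zero] at h
  have h' := congrFun (congrFun h x) (y, y')
  rw [mul_apply] at h'
  exact h'.symm

/-- If `k ≤ e(T)`, then all nonzero indices of degree at most `2k` lie in `T`. -/
theorem mem_of_degree_le_of_le_designStrength {l : ℕ} {D : Finset (Fin l →₀ ℕ)}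
    {T : Set (Fin l →₀ ℕ)} {k : ℕ} (hk : (k : ℕ∞) ≤ designStrength D T) {γ : Fin l →₀ ℕ}
    (hγ : γ ∈ D) (h0 : 0 < γ.degree) (h2 : γ.degree ≤ 2 * k) : γ ∈ T := by
  cases k with
  | zero => omega
  | succ j =>
    -- Going strictly below the supremum yields a qualifying `n > j`, whether or not the supremum is
    -- finite.
    have hj : (j : ℕ∞) < designStrength D T := lt_of_lt_of_le (by exact_mod_cast j.lt_succ_self) hk
    obtain ⟨_, ⟨n, rfl, hn⟩, hlt⟩ := lt_sSup_iff.mp hj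
    have hlt' : j < n := by exact_mod_cast hlt
    exact hn γ hγ h0 (by omega)

namespace AssocScheme

/-! ### The degree filtration by Hadamard monomials -/

section HadamardMonomials

variable {X : Type*} {l : ℕ}

theorem hadamardMonomial_add [Fintype X] (F : Fin l → Matrix X X ℂ) (a b : Fin l →₀ ℕ) :
    hadamardMonomial F (a + b) = (hadamardMonomial F a).hadamard (hadamardMonomial F b) := by
  ext x y
  simp [hadamardMonomial, pow_add, Finset.prod_mul_distrib]

theorem hadamardMonomial_zero_hadamard [Fintype X] (F : Fin l → Matrix X X ℂ)
    (N : Matrix X X ℂ) : (hadamardMonomial F 0).hadamard N = N := by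
  ext x y
  simp [hadamardMonomial]

theorem hadamardMonomial_single [Fintype X] (F : Fin l → Matrix X X ℂ) (i : Fin l) :
    hadamardMonomial F (Finsupp.single i 1) = F i := by
  ext x y
  simp only [hadamardMonomial, Matrix.of_apply]
  rw [Finset.prod_eq_single i]
  · simp
  · intro j _ hj
    simp [hj.symm]
  · simp

/-- The span of the Hadamard monomials with exponent in `D` of degree at most `k`. -/
noncomputable def hadamardSpan [Fintype X] (D : Finset (Fin l →₀ ℕ)) (F : Fin l → Matrix X X ℂ) (k : ℕ) :
    Submodule ℂ (Matrix X X ℂ) :=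
  Submodule.span ℂ {N | ∃ β ∈ D, β.degree ≤ k ∧ N = hadamardMonomial F β}

theorem hadamardSpan_mono [Fintype X] (D : Finset (Fin l →₀ ℕ)) (F : Fin l → Matrix X X ℂ) :
    Monotone (hadamardSpan D F) := fun _ _ hjk =>
  Submodule.span_mono fun _ ⟨β, hβ, hd, hN⟩ => ⟨β, hβ, hd.trans hjk, hN⟩

/-- A sum of two exponents in `D` may leave `D`, so the generators are multiplied in one at a time:
each use of `hF` returns to exponents in `D` and costs one degree. -/
theorem hadamardMonomial_hadamard_mem [Fintype X] {D : Finset (Fin l →₀ ℕ)}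
    {F : Fin l → Matrix X X ℂ}
    (hF : ∀ i k, ∀ N ∈ hadamardSpan D F k, (F i).hadamard N ∈ hadamardSpan D F (k + 1))
    (n : Fin l →₀ ℕ) : ∀ k, ∀ N ∈ hadamardSpan D F k,
      (hadamardMonomial F n).hadamard N ∈ hadamardSpan D F (n.degree + k) := by
  induction n using Finsupp.induction_linear with
  | zero =>
    intro k N hN
    simpa [hadamardMonomial_zero_hadamard] using hN
  | add a b ha hb =>
    intro k N hN
    rw [hadamardMonomial_add, Matrix.hadamard_assoc, map_add, add_assoc]
    exact ha _ _ (hb _ _ hN)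
  | single i c =>
    induction c with
    | zero =>
      intro k N hN
      simpa [hadamardMonomial_zero_hadamard] using hN
    | succ c ih =>
      intro k N hN
      rw [Finsupp.single_add, hadamardMonomial_add, Matrix.hadamard_assoc,
        hadamardMonomial_single, map_add, Finsupp.degree_single i 1, add_assoc, add_comm 1 k]
      exact ih _ _ (hF i k N hN)

theorem hadamard_mem_hadamardSpan [Fintype X] {D : Finset (Fin l →₀ ℕ)}
    {F : Fin l → Matrix X X ℂ}
    (hF : ∀ i k, ∀ N ∈ hadamardSpan D F k, (F i).hadamard N ∈ hadamardSpan D F (k + 1))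
    {j k : ℕ} {M N : Matrix X X ℂ} (hM : M ∈ hadamardSpan D F j) (hN : N ∈ hadamardSpan D F k) :
    M.hadamard N ∈ hadamardSpan D F (j + k) := by
  induction hM using Submodule.span_induction with
  | mem M h =>
    obtain ⟨β, -, hd, rfl⟩ := h
    exact hadamardSpan_mono D F (by omega) (hadamardMonomial_hadamard_mem hF β k N hN)
  | zero => simp
  | add A B _ _ hA hB => rw [Matrix.add_hadamard]; exact add_mem hA hB
  | smul c A _ hA => rw [Matrix.smul_hadamard]; exact Submodule.smul_mem _ c hA

theorem map_star_mem_hadamardSpan [Fintype X] {D : Finset (Fin l →₀ ℕ)}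
    {F : Fin l → Matrix X X ℂ} (hF : ∀ i x y, star (F i x y) = F i x y) {k : ℕ}
    {M : Matrix X X ℂ} (hM : M ∈ hadamardSpan D F k) : M.map star ∈ hadamardSpan D F k := by
  induction hM using Submodule.span_induction with
  | mem M h =>
    obtain ⟨β, hβ, hd, rfl⟩ := h
    refine Submodule.subset_span ⟨β, hβ, hd, ?_⟩
    ext x y
    simp only [hadamardMonomial, Matrix.map_apply, Matrix.of_apply, star_prod, star_pow, hF]
  | zero => simp
  | add A B _ _ hA hB =>
    rw [show (A + B).map star = A.map star + B.map star by ext; simp]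
    exact add_mem hA hB
  | smul c A _ hA =>
    rw [show (c • A).map star = star c • A.map star by ext; simp]
    exact Submodule.smul_mem _ _ hA

end HadamardMonomials

/-! ### Idempotents of the Bose–Mesner algebra and designs -/

section BoseMesner

open Matrix

variable {X I : Type*} [Fintype X] {S : AssocScheme X I}

theorem conjTranspose_mem_boseMesner {M : Matrix X X ℂ} (hM : M ∈ S.boseMesner) :
    Mᴴ ∈ S.boseMesner := by
  induction hM using Submodule.span_induction with
  | mem M h =>
    obtain ⟨i, rfl⟩ := h
    obtain ⟨j, hj⟩ := S.rel_inv i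
    have : (S.adj i)ᴴ = S.adj j := by
      ext x y
      by_cases h : S.rel i y x
      · simp [adj, h, (hj x y).mpr h]
      · simp [adj, h, mt (hj x y).mp h]
    rw [this]
    exact Submodule.subset_span ⟨j, rfl⟩
  | zero => simp
  | add A B _ _ hA hB => rw [conjTranspose_add]; exact add_mem hA hB
  | smul c A _ hA => rw [conjTranspose_smul]; exact Submodule.smul_mem _ _ hA

namespace IsPrimitiveIdempotents

variable {J : Type*} [Fintype J] {E : J → Matrix X X ℂ}

theorem mem_boseMesner (h : S.IsPrimitiveIdempotents E) (j : J) : E j ∈ S.boseMesner :=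
  h.span_eq ▸ Submodule.subset_span ⟨j, rfl⟩

theorem commute_of_mem (h : S.IsPrimitiveIdempotents E) {M : Matrix X X ℂ}
    (hM : M ∈ S.boseMesner) (j : J) : M * E j = E j * M := by
  rw [← h.span_eq] at hM
  induction hM using Submodule.span_induction with
  | mem M hM =>
    obtain ⟨k, rfl⟩ := hM
    rcases eq_or_ne k j with rfl | hkj
    · rfl
    · rw [h.orth _ _ hkj, h.orth _ _ hkj.symm]
  | zero => simp
  | add A B _ _ hA hB => rw [add_mul, mul_add, hA, hB]
  | smul c A _ hA => rw [Matrix.smul_mul, Matrix.mul_smul, hA]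

/-- The Bose–Mesner algebra is closed under conjugate transpose and commutes with each idempotent,
so each idempotent is normal. -/
theorem isHermitian (h : S.IsPrimitiveIdempotents E) (j : J) : (E j).IsHermitian :=
  isHermitian_of_idempotent_of_commute (h.idem j)
    (h.commute_of_mem (conjTranspose_mem_boseMesner (h.mem_boseMesner j)) j)

theorem sum_mul_eq (h : S.IsPrimitiveIdempotents E) {s : Finset J} {j : J} (hj : j ∈ s) :
    (∑ k ∈ s, E k) * E j = E j := by
  rw [Finset.sum_mul, Finset.sum_eq_single_of_mem j hj fun k _ hk => h.orth k j hk, h.idem]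

theorem sum_mul_sum (h : S.IsPrimitiveIdempotents E) (s : Finset J) :
    (∑ k ∈ s, E k) * ∑ k ∈ s, E k = ∑ k ∈ s, E k := by
  rw [Finset.mul_sum]
  exact Finset.sum_congr rfl fun j hj => h.sum_mul_eq hj

theorem isHermitian_sum (h : S.IsPrimitiveIdempotents E) (s : Finset J) :
    (∑ k ∈ s, E k).IsHermitian := by
  rw [IsHermitian, conjTranspose_sum]
  exact Finset.sum_congr rfl fun j _ => h.isHermitian j

/-- For idempotents the rank is the trace, which is additive. -/
theorem rank_sum (h : S.IsPrimitiveIdempotents E) (s : Finset J) :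
    (∑ k ∈ s, E k).rank = ∑ k ∈ s, (E k).rank := by
  have := trace_eq_rank_of_idempotent (h.sum_mul_sum s)
  rw [trace_sum, Finset.sum_congr rfl fun j _ => trace_eq_rank_of_idempotent (h.idem j)] at this
  exact_mod_cast this.symm

theorem sum_mul_of_mem_span (h : S.IsPrimitiveIdempotents E) {s : Finset J} {M : Matrix X X ℂ}
    (hM : M ∈ Submodule.span ℂ (E '' s)) : (∑ k ∈ s, E k) * M = M := by
  induction hM using Submodule.span_induction with
  | mem M hM =>
    obtain ⟨j, hj, rfl⟩ := hM
    exact h.sum_mul_eq hj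
  | zero => simp
  | add A B _ _ hA hB => rw [mul_add, hA, hB]
  | smul c A _ hA => rw [Matrix.mul_smul, hA]

end IsPrimitiveIdempotents

/-- The sum of the entries of `M` over `Y × Y`, in terms of the inner distribution. -/
theorem sum_innerDistribution_mul_secondEigenvalue [Fintype I] {M : Matrix X X ℂ}
    (hM : M ∈ S.boseMesner) {Y : Finset X} (hY : Y.Nonempty) :
    (Y.card : ℂ) * ∑ i, (S.innerDistribution Y i : ℂ) * S.secondEigenvalue M i =
      (Fintype.card X : ℂ) * ∑ x ∈ Y, ∑ y ∈ Y, M x y := by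
  classical
  have hY0 : (Y.card : ℂ) ≠ 0 := by exact_mod_cast hY.card_pos.ne'
  have hentry : ∀ x y, (Fintype.card X : ℂ) * M x y =
      ∑ i, S.secondEigenvalue M i * S.adj i x y := by
    intro x y
    have := congrFun (congrFun (S.secondEigenvalue_spec M hM) x) y
    simpa [Matrix.sum_apply] using this
  have hcount : ∀ i, (Y.card : ℂ) * (S.innerDistribution Y i : ℂ) =
      ∑ x ∈ Y, ∑ y ∈ Y, S.adj i x y := by
    intro i
    rw [innerDistribution]
    push_cast
    rw [mul_div_cancel₀ _ hY0, Nat.card_eq_fintype_card, Fintype.card_subtype,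
      ← Finset.sum_product' (f := fun x y => S.adj i x y)]
    simp only [adj, of_apply, Finset.sum_boole]
    congr 2
    ext q
    simp [and_assoc]
  simp only [Finset.mul_sum, hentry]
  rw [Finset.sum_congr rfl fun x _ => Finset.sum_comm, Finset.sum_comm]
  refine Finset.sum_congr rfl fun i _ => ?_
  rw [← mul_assoc, hcount, mul_comm, Finset.mul_sum]
  exact Finset.sum_congr rfl fun x _ => Finset.mul_sum _ _ _

open scoped ComplexOrder in
/-- The characteristic vector of a design is orthogonal to the eigenspaces indexed by `T`. -/
theorem IsTDesign.sum_column_eq_zero [Fintype I] {l : ℕ} {D : Finset (Fin l →₀ ℕ)}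
    {E : D → Matrix X X ℂ} (hE : S.IsPrimitiveIdempotents E) {T : Set (Fin l →₀ ℕ)}
    {Y : Finset X} (hY : Y.Nonempty) (hYT : S.IsTDesign E T Y) {γ : D}
    (hγ : (γ : Fin l →₀ ℕ) ∈ T) (y : X) : ∑ x ∈ Y, E γ x y = 0 := by
  classical
  have hX : (Fintype.card X : ℂ) ≠ 0 := by
    have : Nonempty X := ⟨y⟩
    exact_mod_cast Fintype.card_ne_zero
  have hsum : ∑ x ∈ Y, ∑ y ∈ Y, E γ x y = 0 := by
    have h := sum_innerDistribution_mul_secondEigenvalue (hE.mem_boseMesner γ) hY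
    rw [hYT γ hγ, mul_zero] at h
    exact (mul_eq_zero.mp h.symm).resolve_left hX
  let w : X → ℂ := fun x => if x ∈ Y then 1 else 0
  have hw : ∀ y, (w ᵥ* E γ) y = ∑ x ∈ Y, E γ x y := fun y => by
    simp [w, vecMul, dotProduct]
  have hstar : star (w ᵥ* E γ) = E γ *ᵥ w := by
    rw [star_vecMul, (hE.isHermitian γ).eq]
    congr 1
    ext x
    by_cases hx : x ∈ Y <;> simp [w, hx]
  -- The idempotent is Hermitian and `w` is real, so the squared norm of `w ᵥ* E γ` is the sum of
  -- the entries of `E γ` over `Y × Y`, which vanishes.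
  have hzero : w ᵥ* E γ = 0 := by
    rw [← dotProduct_self_star_eq_zero, hstar, dotProduct_mulVec, vecMul_vecMul, hE.idem]
    simp only [dotProduct, hw, w, mul_ite, mul_one, mul_zero, Finset.sum_ite_mem,
      Finset.univ_inter]
    rw [Finset.sum_comm]
    exact hsum
  rw [← hw, hzero, Pi.zero_apply]

end BoseMesner

/-! ### Consequences of the `Q`-polynomial property -/

namespace IsQPolynomial

variable {X I : Type*} [Fintype X] {S : AssocScheme X I} {l : ℕ} {m : MonomialOrder (Fin l)}
  {D : Finset (Fin l →₀ ℕ)} {E : D → Matrix X X ℂ}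

/-- The generators `E_{ε_i}`. -/
noncomputable def generator (hQ : S.IsQPolynomial m D E) (i : Fin l) : Matrix X X ℂ :=
  E ⟨Finsupp.single i 1, hQ.eps_mem i⟩

theorem zero_mem [Nonempty X] (hQ : S.IsQPolynomial m D E) : (0 : Fin l →₀ ℕ) ∈ D := by
  classical
  have hne : D.Nonempty := by
    by_contra hD
    have : IsEmpty D := by
      rw [Finset.not_nonempty_iff_eq_empty] at hD
      subst hD
      infer_instance
    have h := hQ.primitive.sum_eq_one
    rw [Finset.univ_eq_empty, Finset.sum_empty] at h
    exact zero_ne_one h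
  obtain ⟨n, hn⟩ := hne
  exact hQ.lower n hn 0 fun i => by simp

/-- The order is graded, so the multidegree bounds the total degree of every monomial of `v`; the
powers of `|X|` go into the coefficients. -/
theorem mem_hadamardSpan [Nonempty X] (hQ : S.IsQPolynomial m D E)
    (hm : ∀ a b : Fin l →₀ ℕ, a ≼[m] b → a.degree ≤ b.degree) (α : D) :
    E α ∈ hadamardSpan D hQ.generator α.1.degree := by
  have hX : (Fintype.card X : ℂ) ≠ 0 := by exact_mod_cast Fintype.card_ne_zero
  obtain ⟨v, hv, hvD, heval⟩ := hQ.poly α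
  have hE : E α = ∑ β ∈ v.support, ((Fintype.card X : ℂ)⁻¹ * v.coeff β *
      ∏ i, (Fintype.card X : ℂ) ^ β i) • hadamardMonomial hQ.generator β := by
    ext x y
    rw [eq_comm, ← mul_right_inj' hX, heval x y, MvPolynomial.eval_eq', Matrix.sum_apply,
      Finset.mul_sum]
    refine Finset.sum_congr rfl fun β _ => ?_
    simp only [mul_pow, Finset.prod_mul_distrib, Matrix.smul_apply, hadamardMonomial,
      Matrix.of_apply, generator, smul_eq_mul]
    field_simp
  rw [hE]
  exact Submodule.sum_mem _ fun β hβ => Submodule.smul_mem _ _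
    (Submodule.subset_span ⟨β, hvD β hβ, hm _ _ (hv.2 β hβ), rfl⟩)

theorem generator_hadamard_mem (hQ : S.IsQPolynomial m D E)
    (hm : ∀ a b : Fin l →₀ ℕ, a ≼[m] b → a.degree ≤ b.degree) (i : Fin l) (k : ℕ)
    (N : Matrix X X ℂ) (hN : N ∈ hadamardSpan D hQ.generator k) :
    (hQ.generator i).hadamard N ∈ hadamardSpan D hQ.generator (k + 1) := by
  induction hN using Submodule.span_induction with
  | mem N h =>
    obtain ⟨α, hα, hd, rfl⟩ := h
    refine Submodule.span_mono ?_ (hQ.mul_eps i α hα)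
    rintro _ ⟨β, hβ, hle, rfl⟩
    refine ⟨β, hβ, (hm _ _ hle).trans ?_, rfl⟩
    rw [map_add, Finsupp.degree_single]
    omega
  | zero => simp
  | add A B _ _ hA hB => rw [Matrix.hadamard_add]; exact add_mem hA hB
  | smul c A _ hA => rw [Matrix.hadamard_smul]; exact Submodule.smul_mem _ c hA

/-- The Hadamard monomials and the primitive idempotents of degree at most `k` have the same span,
by comparing dimensions. -/
theorem hadamardSpan_eq_span [Nonempty X] (hQ : S.IsQPolynomial m D E)
    (hm : ∀ a b : Fin l →₀ ℕ, a ≼[m] b → a.degree ≤ b.degree) (k : ℕ) :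
    hadamardSpan D hQ.generator k =
      Submodule.span ℂ (E '' (Finset.univ.filter fun γ : D => γ.1.degree ≤ k : Finset D)) := by
  classical
  symm
  set s : Finset D := Finset.univ.filter fun γ : D => γ.1.degree ≤ k with hs
  have himage : E '' s = Set.range fun γ : s => E γ.1 := by
    ext M
    simp [Set.mem_image]
  have hset : {N | ∃ β ∈ D, β.degree ≤ k ∧ N = hadamardMonomial hQ.generator β} =
      Set.range fun γ : s => hadamardMonomial hQ.generator γ.1.1 := by
    ext N
    constructor
    · rintro ⟨β, hβ, hd, rfl⟩
      exact ⟨⟨⟨β, hβ⟩, by simpa [hs] using hd⟩, rfl⟩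
    · rintro ⟨γ, rfl⟩
      exact ⟨γ.1.1, γ.1.2, (Finset.mem_filter.mp γ.2).2, rfl⟩
  refine Submodule.eq_of_le_of_finrank_le ?_ ?_
  · rw [Submodule.span_le]
    rintro _ ⟨γ, hγ, rfl⟩
    exact hadamardSpan_mono D _ (Finset.mem_filter.mp hγ).2 (hQ.mem_hadamardSpan hm γ)
  -- The idempotents indexed by `s` are independent, while the monomial span has a generating family
  -- indexed by the same `s`.
  · rw [himage, finrank_span_eq_card (b := fun γ : s => E γ.1)
      (hQ.primitive.linearIndependent.comp _ Subtype.val_injective), hadamardSpan, hset]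
    exact finrank_range_le_card _

/-- The idempotent labelled by `0` is `|X|⁻¹ J`. -/
theorem zero_apply [Nonempty X] (hQ : S.IsQPolynomial m D E)
    (hm : ∀ a b : Fin l →₀ ℕ, a ≼[m] b → a.degree ≤ b.degree) (x y : X) :
    E ⟨0, hQ.zero_mem⟩ x y = (Fintype.card X : ℂ)⁻¹ := by
  have hX : (Fintype.card X : ℂ) ≠ 0 := by exact_mod_cast Fintype.card_ne_zero
  obtain ⟨v, hv, -, heval⟩ := hQ.poly ⟨0, hQ.zero_mem⟩
  have hsupp : v.support = {0} := by
    ext β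
    rw [Finset.mem_singleton]
    constructor
    · intro hβ
      have := hm _ _ (hv.2 β hβ)
      rw [map_zero] at this
      exact (Finsupp.degree_eq_zero_iff β).mp (Nat.le_zero.mp this)
    · rintro rfl
      exact MvPolynomial.mem_support_iff.mpr hv.1
  have hc : ∀ x y, (Fintype.card X : ℂ) * E ⟨0, hQ.zero_mem⟩ x y = v.coeff 0 := by
    intro x y
    rw [heval x y, MvPolynomial.eval_eq', hsupp]
    simp
  have hc0 : v.coeff 0 ≠ 0 := hv.1
  have hE : ∀ x y, E ⟨0, hQ.zero_mem⟩ x y = (Fintype.card X : ℂ)⁻¹ * v.coeff 0 := by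
    intro x y
    rw [← hc x y, inv_mul_cancel_left₀ hX]
  -- A constant matrix with nonzero entry `c / |X|` is idempotent only if `c = 1`.
  have hidem := congrFun (congrFun (hQ.primitive.idem ⟨0, hQ.zero_mem⟩) x) y
  simp only [Matrix.mul_apply, hE, Finset.sum_const, Finset.card_univ, nsmul_eq_mul] at hidem
  have hone : v.coeff 0 = 1 := by
    field_simp at hidem
    exact hidem
  rw [hE, hone, mul_one]

/-- This is where the reality of the points `z` enters: it keeps the degree filtration stable under
entrywise conjugation. -/
theorem star_generator [Fintype I] [Nonempty X] (hQ : S.IsQPolynomial m D E) {z : I → Fin l → ℝ}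
    (hz : ∀ α i, S.secondEigenvalue (E ⟨Finsupp.single i 1, hQ.eps_mem i⟩) α = (z α i : ℂ))
    (i : Fin l) (x y : X) : star (hQ.generator i x y) = hQ.generator i x y := by
  have hX : (Fintype.card X : ℂ) ≠ 0 := by exact_mod_cast Fintype.card_ne_zero
  have h := congrFun (congrFun (S.secondEigenvalue_spec _
    (hQ.primitive.mem_boseMesner ⟨Finsupp.single i 1, hQ.eps_mem i⟩)) x) y
  simp only [hz, Matrix.sum_apply, Matrix.smul_apply, smul_eq_mul] at h
  rw [← mul_right_inj' hX, generator]
  have h' := congrArg star h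
  rw [star_mul', star_natCast, star_sum] at h'
  rw [h', h]
  refine Finset.sum_congr rfl fun α _ => ?_
  rw [adj, Matrix.of_apply]
  split_ifs <;> simp

/-- If `Y` is orthogonal to all nontrivial eigenspaces of degree at most `2k`, then the rank of the
projection onto the eigenspaces of degree at most `k` is at most `|Y|`. -/
theorem rank_sum_le_card [Fintype I] [Nonempty X] (hQ : S.IsQPolynomial m D E)
    (hm : ∀ a b : Fin l →₀ ℕ, a ≼[m] b → a.degree ≤ b.degree) {z : I → Fin l → ℝ}
    (hz : ∀ α i, S.secondEigenvalue (E ⟨Finsupp.single i 1, hQ.eps_mem i⟩) α = (z α i : ℂ))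
    {Y : Finset X} (hY : Y.Nonempty) {k : ℕ}
    (hdesign : ∀ γ : D, 0 < γ.1.degree → γ.1.degree ≤ 2 * k → ∀ y, ∑ x ∈ Y, E γ x y = 0) :
    (∑ γ ∈ Finset.univ.filter (fun γ : D => γ.1.degree ≤ k), E γ).rank ≤ Y.card := by
  classical
  have hX : (Fintype.card X : ℂ) ≠ 0 := by exact_mod_cast Fintype.card_ne_zero
  have hYc : (Y.card : ℂ) ≠ 0 := by exact_mod_cast hY.card_pos.ne'
  set P := ∑ γ ∈ Finset.univ.filter (fun γ : D => γ.1.degree ≤ k), E γ with hPdef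
  set Q := ∑ γ ∈ Finset.univ.filter (fun γ : D => γ.1.degree ≤ 2 * k), E γ with hQdef
  have hP : P * P = P := hQ.primitive.sum_mul_sum _
  have hH : P.IsHermitian := hQ.primitive.isHermitian_sum _
  have hPmem : P ∈ hadamardSpan D hQ.generator k := Submodule.sum_mem _ fun γ hγ =>
    hadamardSpan_mono D _ (Finset.mem_filter.mp hγ).2 (hQ.mem_hadamardSpan hm γ)
  have hQP : Q * P.hadamard (P.map star) = P.hadamard (P.map star) := by
    apply hQ.primitive.sum_mul_of_mem_span
    rw [← hQ.hadamardSpan_eq_span hm, two_mul]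
    exact hadamard_mem_hadamardSpan (hQ.generator_hadamard_mem hm) hPmem
      (map_star_mem_hadamardSpan (hQ.star_generator hz) hPmem)
  -- The design condition kills every term of `Q` except the constant matrix `E_0`.
  have hcol : ∀ y, ∑ x ∈ Y, Q x y = (Y.card : ℂ) * (Fintype.card X : ℂ)⁻¹ := by
    intro y
    simp only [hQdef, Matrix.sum_apply]
    rw [Finset.sum_comm, Finset.sum_eq_single_of_mem ⟨0, hQ.zero_mem⟩ (by simp)]
    · simp only [hQ.zero_apply hm, Finset.sum_const, nsmul_eq_mul]
    · intro γ hγ hne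
      refine hdesign γ (Nat.pos_of_ne_zero fun h => hne ?_) (Finset.mem_filter.mp hγ).2 y
      exact Subtype.ext ((Finsupp.degree_eq_zero_iff γ.1).mp h)
  -- Inserting `Q` in front of the product replaces the sum over `Y` by a multiple of the sum over
  -- `X`, which `P * P = P` evaluates.
  have hgram : ∀ y y', ∑ x ∈ Y, P x y * star (P x y') =
      (Y.card : ℂ) * (Fintype.card X : ℂ)⁻¹ * P y' y := by
    intro y y'
    rw [← Finset.sum_congr rfl fun x _ => Matrix.sum_mul_column_mul_star_column hP hH hQP x y y',
      Finset.sum_comm]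
    simp only [← Finset.sum_mul, hcol, ← Finset.mul_sum]
    congr 1
    conv_rhs => rw [← hP, Matrix.mul_apply]
    exact Finset.sum_congr rfl fun x _ => by rw [hH.apply, mul_comm]
  let R : Matrix Y X ℂ := P.submatrix Subtype.val id
  have hPR : P = ((Fintype.card X : ℂ) * (Y.card : ℂ)⁻¹) • R.conjTranspose * R := by
    ext y' y
    rw [Matrix.smul_mul, Matrix.smul_apply, Matrix.mul_apply, smul_eq_mul]
    have : ∑ j : Y, R.conjTranspose y' j * R j y = ∑ x ∈ Y, P x y * star (P x y') := by
      rw [← Finset.sum_coe_sort Y]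
      exact Finset.sum_congr rfl fun x _ => mul_comm _ _
    rw [this, hgram]
    field_simp
  rw [hPR]
  refine (Matrix.rank_mul_le_right _ _).trans ((Matrix.rank_le_card_height R).trans ?_)
  simp

end IsQPolynomial

end AssocScheme

theorem mainTheorem6 {X I : Type*} [Fintype X] [Nontrivial X] [Fintype I]
    (S : AssocScheme X I) {l : ℕ}
    (m : MonomialOrder (Fin l))
    (hm : ∀ a b : Fin l →₀ ℕ, a ≼[m] b → a.degree ≤ b.degree)
    (D : Finset (Fin l →₀ ℕ)) (E : D → Matrix X X ℂ)
    (hQ : S.IsQPolynomial m D E)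
    (z : I → Fin l → ℝ)
    (hz : ∀ α i, S.secondEigenvalue (E ⟨Finsupp.single i 1, hQ.eps_mem i⟩) α = (z α i : ℂ))
    (T : Set (Fin l →₀ ℕ)) (hTD : T ⊆ (D : Set (Fin l →₀ ℕ))) (hT0 : 0 ∉ T)
    (Y : Finset X) (hY : Y.Nonempty) (hYT : S.IsTDesign E T Y) :
    ∑ γ ∈ (Finset.univ : Finset D).filter
        (fun γ : D => (γ.1.degree : ℕ∞) ≤ designStrength D T), (E γ).rank ≤ Y.card := by
  classical
  rcases ((Finset.univ : Finset D).filter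
    (fun γ : D => (γ.1.degree : ℕ∞) ≤ designStrength D T)).eq_empty_or_nonempty with hs | hs
  · rw [hs]
    simp
  obtain ⟨δ, hδ, hmax⟩ := Finset.exists_max_image _ (fun γ : D => γ.1.degree) hs
  have hδs := (Finset.mem_filter.mp hδ).2
  have hrank := hQ.rank_sum_le_card hm hz hY (k := δ.1.degree) fun γ h0 h2 y =>
    hYT.sum_column_eq_zero hQ.primitive hY
      (mem_of_degree_le_of_le_designStrength hδs γ.2 h0 h2) y
  rw [hQ.primitive.rank_sum] at hrank
  refine (Finset.sum_le_sum_of_subset fun γ hγ => ?_).trans hrank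
  exact Finset.mem_filter.mpr ⟨Finset.mem_univ _, hmax γ hγ⟩
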